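/- Let $k$ be an algebraically closed field of characteristic $0$ and let $\mathfrak f=\mathfrak{sl}(1|1)$ be the Lie superalgebra of $(1|1)\times(1|1)$ matrices over $k$ of supertrace zero, with the supercommutator bracket. Let $\mathcal F$ be the category of finite-dimensional $\mathfrak f$-supermodules that are completely reducible over $\mathfrak f_{\overline 0}$. Let $M\in\mathcal F$ be indecomposable and not projective in $\mathcal F$. Suppose that $M$ is of strong constant Jordan type $(a_{ev}|a_{od})[1]+a_2[2]$, that is, for every nonzero $z\in\mathfrak f_{\overline 1}$ (whether or not $[z,z]=0$) the element $z$ acts on $M$ with square zero, and as a supermodule over $k[z]/(z^2)$ $$M|_{\langle z\rangle}\cong k_{ev}^{\oplus a_{ev}}\oplus k_{od}^{\oplus a_{od}}\oplus P^{\oplus a_2},$$ where $k_{ev}$ and $k_{od}$ are the trivial modules in even and odd degree, $P$ is, up to parity change in each copy, the two-dimensional projective indecomposable $k[z]/(z^2)$-supermodule, and the numbers $a_{ev},a_{od},a_2$ do not depend on $z$. Then exactly one of $a_{ev}$ and $a_{od}$ is $0$; that is, there are trivial summands in the Jordan decomposition of $M$, and they all have the same parity. -/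

import Mathlib

universe u v w

/-- A super vector space over `k`: a vector space `V = V₀ ⊕ V₁` graded by `ℤ/2`. -/
class SuperVectorSpace (k : Type u) (V : Type v) [Field k] [AddCommGroup V] [Module k V] where
  /-- the homogeneous component of parity `i` -/
  part : ZMod 2 → Submodule k V
  isCompl_part : IsCompl (part 0) (part 1)

/-- `superPart k V i` is the homogeneous component of parity `i` of the super vector space `V`. -/
abbrev superPart (k : Type u) (V : Type v) [Field k] [AddCommGroup V] [Module k V]
    [SuperVectorSpace k V] (i : ZMod 2) : Submodule k V :=
  SuperVectorSpace.part i

/-- The sign `(-1)^{ij}` for parities `i`, `j`. -/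
def superSign (k : Type u) [Field k] (i j : ZMod 2) : k := (-1) ^ (i.val * j.val)

/-- A Lie superalgebra over `k` (of characteristic zero). -/
class LieSuperalgebra (k : Type u) (L : Type v) [Field k] [AddCommGroup L] [Module k L]
    extends SuperVectorSpace k L where
  bracket : L →ₗ[k] L →ₗ[k] L
  bracket_mem : ∀ {i j : ZMod 2} {a b : L}, a ∈ part i → b ∈ part j → bracket a b ∈ part (i + j)
  bracket_skew : ∀ {i j : ZMod 2} {a b : L}, a ∈ part i → b ∈ part j →
    bracket a b = -(superSign k i j • bracket b a)
  bracket_jacobi : ∀ {i j : ZMod 2} {a b : L} (c : L), a ∈ part i → b ∈ part j →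
    bracket a (bracket b c) = bracket (bracket a b) c + superSign k i j • bracket b (bracket a c)

/-- A supermodule over the Lie superalgebra `L`: a super vector space `V` with a parity-respecting
action of `L` in which the bracket acts by the supercommutator. -/
class LieSupermodule (k : Type u) (L : Type w) (V : Type v) [Field k] [AddCommGroup L] [Module k L]
    [LieSuperalgebra k L] [AddCommGroup V] [Module k V] extends SuperVectorSpace k V where
  act : L →ₗ[k] Module.End k V
  act_mem : ∀ {i j : ZMod 2} {a : L} {m : V}, a ∈ superPart k L i → m ∈ part j →
    act a m ∈ part (i + j)
  act_bracket : ∀ {i j : ZMod 2} {a b : L} (m : V), a ∈ superPart k L i → b ∈ superPart k L j →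
    act (LieSuperalgebra.bracket (k := k) a b) m =
      act a (act b m) - superSign k i j • act b (act a m)

section supermodules

variable (k : Type u) (L : Type w) [Field k] [AddCommGroup L] [Module k L] [LieSuperalgebra k L]
variable (V : Type v) [AddCommGroup V] [Module k V] [LieSupermodule k L V]

/-- The endomorphism of `V` by which `a : L` acts. -/
abbrev superAct (a : L) : Module.End k V := LieSupermodule.act a

/-- The grading of the supermodule `V`. -/
abbrev modPart (i : ZMod 2) : Submodule k V :=
  (LieSupermodule.toSuperVectorSpace (k := k) (L := L) (V := V)).part i

variable {V} in
/-- `W` is a graded subspace of the supermodule `V`, i.e. spanned by its homogeneous elements. -/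
def IsGradedSubspace (W : Submodule k V) : Prop :=
  W = (W ⊓ modPart k L V 0) ⊔ (W ⊓ modPart k L V 1)

variable {V} in
/-- `W` is a sub-supermodule of `V` over `L`. -/
def IsSubsupermodule (W : Submodule k V) : Prop :=
  IsGradedSubspace k L W ∧ ∀ a : L, ∀ m ∈ W, superAct k L V a m ∈ W

variable {V} in
/-- `W` is a sub-supermodule of the restriction of `V` to the even part of `L`. -/
def IsEvenSubsupermodule (W : Submodule k V) : Prop :=
  IsGradedSubspace k L W ∧ ∀ a ∈ superPart k L 0, ∀ m ∈ W, superAct k L V a m ∈ W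

/-- The category `ℱ` of finite dimensional `L`-supermodules which are completely
reducible over the even part of `L`. -/
structure InCategoryF : Prop where
  finiteDimensional : FiniteDimensional k V
  completelyReducible : ∀ W : Submodule k V, IsEvenSubsupermodule k L W →
    ∃ W' : Submodule k V, IsEvenSubsupermodule k L W' ∧ IsCompl W W'

/-- `V` is indecomposable: nonzero, and not a direct sum of two nonzero sub-supermodules. -/
def IsIndecomposableSupermodule : Prop :=
  Nontrivial V ∧ ∀ A B : Submodule k V, IsSubsupermodule k L A → IsSubsupermodule k L B →
    IsCompl A B → A = ⊥ ∨ B = ⊥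

variable {V} in
/-- `f` is a morphism of `L`-supermodules (an even linear map commuting with the action). -/
def IsSupermoduleHom {W : Type*} [AddCommGroup W] [Module k W] [LieSupermodule k L W]
    (f : V →ₗ[k] W) : Prop :=
  (∀ i, ∀ m ∈ modPart k L V i, f m ∈ modPart k L W i) ∧
    ∀ (a : L) (m : V), f (superAct k L V a m) = superAct k L W a (f m)

/-- `V` is a projective object of the category `ℱ` of `L`-supermodules. -/
def IsProjectiveInF : Prop :=
  InCategoryF k L V ∧
  ∀ (N N' : Type (max u v)) [AddCommGroup N] [Module k N] [LieSupermodule k L N]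
    [AddCommGroup N'] [Module k N'] [LieSupermodule k L N']
    (_ : InCategoryF k L N) (_ : InCategoryF k L N')
    (p : N →ₗ[k] N') (f : V →ₗ[k] N'), IsSupermoduleHom k L p → Function.Surjective p →
    IsSupermoduleHom k L f →
    ∃ g : V →ₗ[k] N, IsSupermoduleHom k L g ∧ p ∘ₗ g = f

/-- The super Jordan type of `V` at the odd element `z` is `(aev|aod)[1] + a₂[2]`: restricted to
`z`, the supermodule `V` is the direct sum of `aev` even and `aod` odd trivial lines and of `a₂`
copies, up to parity, of the two-dimensional module with basis `p, z p` where `z (z p) = 0`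
(the projective indecomposable module over `k[z]/(z²)`). In particular `z` acts with square zero. -/
def HasSuperJordanTypeAt (z : L) (aev aod a₂ : ℕ) : Prop :=
  ∃ b : Module.Basis (Fin aev ⊕ Fin aod ⊕ (Fin a₂ × Fin 2)) k V,
    (∀ i, b (.inl i) ∈ modPart k L V 0 ∧ superAct k L V z (b (.inl i)) = 0) ∧
    (∀ i, b (.inr (.inl i)) ∈ modPart k L V 1 ∧ superAct k L V z (b (.inr (.inl i))) = 0) ∧
    ∀ l, (∃ j, b (.inr (.inr (l, 0))) ∈ modPart k L V j) ∧
      superAct k L V z (b (.inr (.inr (l, 0)))) = b (.inr (.inr (l, 1))) ∧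
      superAct k L V z (b (.inr (.inr (l, 1)))) = 0

/-- `V` is of strong constant Jordan type `(aev|aod)[1] + a₂[2]`: this is its super Jordan type at
every nonzero odd element of `L`, whether or not that element is self-commuting. -/
def HasStrongConstantJordanType (aev aod a₂ : ℕ) : Prop :=
  ∀ z ∈ superPart k L 1, z ≠ 0 → HasSuperJordanTypeAt k L V z aev aod a₂

end supermodules

section sl11

variable (k : Type u) [Field k]

/-- The supertrace of a `(1|1) × (1|1)` matrix. -/
def supertrace11 : Matrix (Fin 2) (Fin 2) k →ₗ[k] k where
  toFun A := A 0 0 - A 1 1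
  map_add' A B := by simp only [Matrix.add_apply]; ring
  map_smul' c A := by simp only [Matrix.smul_apply, smul_eq_mul, RingHom.id_apply]; ring

/-- `𝔰𝔩(1|1)`, the `(1|1) × (1|1)` matrices of supertrace zero. -/
abbrev SL11 : Type u := LinearMap.ker (supertrace11 k)

variable {k}

theorem SL11.diag (A : SL11 k) : A.1 1 1 = A.1 0 0 :=
  (sub_eq_zero.mp (LinearMap.mem_ker.mp A.2)).symm

/-- The off-diagonal (odd) part of a `(1|1) × (1|1)` matrix. -/
def oddPart11 (A : Matrix (Fin 2) (Fin 2) k) : Matrix (Fin 2) (Fin 2) k :=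
  !![0, A 0 1; A 1 0, 0]

/-- The bilinear supercommutator of `(1|1) × (1|1)` matrices: `A * B + B * A` if `A` and `B`
are both odd, and `A * B - B * A` if one of them is even. -/
def superBracket11 (A B : Matrix (Fin 2) (Fin 2) k) : Matrix (Fin 2) (Fin 2) k :=
  A * B - B * A + (2 : k) • (oddPart11 B * oddPart11 A)

theorem superBracket11_mem (A B : SL11 k) :
    superBracket11 A.1 B.1 ∈ LinearMap.ker (supertrace11 k) := by
  have hA := SL11.diag A
  have hB := SL11.diag B
  rw [LinearMap.mem_ker]
  simp [supertrace11, superBracket11, oddPart11, Matrix.mul_apply, Fin.sum_univ_two]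
  ring

variable (k) in
/-- Even part of `𝔰𝔩(1|1)`: diagonal matrices. Odd part: matrices with zero diagonal. -/
def SL11.gradedPart (i : ZMod 2) : Submodule k (SL11 k) where
  carrier := {A | if i = 0 then A.1 0 1 = 0 ∧ A.1 1 0 = 0 else A.1 0 0 = 0 ∧ A.1 1 1 = 0}
  add_mem' := by
    intro A B hA hB
    by_cases h : i = 0 <;> simp_all
  zero_mem' := by by_cases h : i = 0 <;> simp [h]
  smul_mem' := by
    intro c A hA
    by_cases h : i = 0 <;> simp_all

theorem SL11.mem_even (A : SL11 k) :
    A ∈ SL11.gradedPart k 0 ↔ A.1 0 1 = 0 ∧ A.1 1 0 = 0 := by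
  change (if (0 : ZMod 2) = 0 then A.1 0 1 = 0 ∧ A.1 1 0 = 0 else A.1 0 0 = 0 ∧ A.1 1 1 = 0) ↔ _
  simp

theorem SL11.mem_odd (A : SL11 k) :
    A ∈ SL11.gradedPart k 1 ↔ A.1 0 0 = 0 ∧ A.1 1 1 = 0 := by
  change (if (1 : ZMod 2) = 0 then A.1 0 1 = 0 ∧ A.1 1 0 = 0 else A.1 0 0 = 0 ∧ A.1 1 1 = 0) ↔ _
  simp

theorem SL11.ext_entries {A B : SL11 k} (h₀ : A.1 0 0 = B.1 0 0) (h₁ : A.1 0 1 = B.1 0 1)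
    (h₂ : A.1 1 0 = B.1 1 0) : A = B := by
  have hA := SL11.diag A
  have hB := SL11.diag B
  apply Subtype.ext
  ext i j
  fin_cases i <;> fin_cases j <;> simp_all

variable (k) in
/-- The bracket of `𝔰𝔩(1|1)`. -/
def SL11.bracket : SL11 k →ₗ[k] SL11 k →ₗ[k] SL11 k :=
  LinearMap.mk₂ k (fun A B => ⟨superBracket11 A.1 B.1, superBracket11_mem A B⟩)
    (by
      intro A B C
      apply SL11.ext_entries <;>
        simp [superBracket11, oddPart11, Matrix.mul_apply, Fin.sum_univ_two] <;> ring)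
    (by
      intro c A B
      apply SL11.ext_entries <;>
        simp [superBracket11, oddPart11, Matrix.mul_apply, Fin.sum_univ_two] <;> ring)
    (by
      intro A B C
      apply SL11.ext_entries <;>
        simp [superBracket11, oddPart11, Matrix.mul_apply, Fin.sum_univ_two] <;> ring)
    (by
      intro c A B
      apply SL11.ext_entries <;>
        simp [superBracket11, oddPart11, Matrix.mul_apply, Fin.sum_univ_two] <;> ring)

theorem SL11.bracket_coe (A B : SL11 k) :
    (SL11.bracket k A B).1 = superBracket11 A.1 B.1 := rfl

/-- In coordinates, with `A = a t + b x + c y`: `[A, B] = (b_A c_B + c_A b_B) t`. -/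
theorem SL11.bracket_entries (A B : SL11 k) :
    (SL11.bracket k A B).1 0 0 = A.1 0 1 * B.1 1 0 + A.1 1 0 * B.1 0 1 ∧
    (SL11.bracket k A B).1 0 1 = 0 ∧ (SL11.bracket k A B).1 1 0 = 0 := by
  have hA := SL11.diag A
  have hB := SL11.diag B
  rw [SL11.bracket_coe]
  refine ⟨?_, ?_, ?_⟩ <;>
    simp [superBracket11, oddPart11, Matrix.mul_apply, Fin.sum_univ_two, hA, hB] <;> ring

instance SL11.instLieSuperalgebra : LieSuperalgebra k (SL11 k) where
  part := SL11.gradedPart k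
  isCompl_part := by
    constructor
    · rw [Submodule.disjoint_def]
      intro A h₀ h₁
      rw [SL11.mem_even] at h₀
      rw [SL11.mem_odd] at h₁
      exact SL11.ext_entries (by simp [h₁.1]) (by simp [h₀.1]) (by simp [h₀.2])
    · rw [codisjoint_iff, eq_top_iff]
      intro A _
      have hA := SL11.diag A
      rw [Submodule.mem_sup]
      refine ⟨⟨!![A.1 0 0, 0; 0, A.1 0 0], by simp [supertrace11]⟩, (SL11.mem_even _).2 (by simp),
        ⟨oddPart11 A.1, by simp [supertrace11, oddPart11]⟩,
        (SL11.mem_odd _).2 (by simp [oddPart11]), ?_⟩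
      apply SL11.ext_entries <;> simp [oddPart11]
  bracket := SL11.bracket k
  bracket_mem := by
    intro i j A B hA hB
    obtain ⟨h₀, h₁, h₂⟩ := SL11.bracket_entries A B
    have hd := SL11.diag (SL11.bracket k A B)
    fin_cases i <;> fin_cases j
    · exact (SL11.mem_even _).2 ⟨h₁, h₂⟩
    · obtain ⟨a, b⟩ := (SL11.mem_even A).1 hA
      exact (SL11.mem_odd _).2 (by rw [hd, h₀, a, b]; simp)
    · obtain ⟨a, b⟩ := (SL11.mem_even B).1 hB
      exact (SL11.mem_odd _).2 (by rw [hd, h₀, a, b]; simp)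
    · exact (SL11.mem_even _).2 ⟨h₁, h₂⟩
  bracket_skew := by
    intro i j A B hA hB
    obtain ⟨h₀, h₁, h₂⟩ := SL11.bracket_entries A B
    obtain ⟨g₀, g₁, g₂⟩ := SL11.bracket_entries B A
    apply SL11.ext_entries
    · fin_cases i <;> fin_cases j
      · obtain ⟨a, b⟩ := (SL11.mem_even A).1 hA
        simp [h₀, g₀, a, b]
      · obtain ⟨a, b⟩ := (SL11.mem_even A).1 hA
        simp [h₀, g₀, a, b]
      · obtain ⟨a, b⟩ := (SL11.mem_even B).1 hB
        simp [h₀, g₀, a, b]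
      · have hs : superSign k (1 : ZMod 2) 1 = -1 := by simp [superSign, ZMod.val_one]
        change (SL11.bracket k A B).1 0 0 =
          -(superSign k (1 : ZMod 2) 1 • (SL11.bracket k B A).1 0 0)
        rw [hs, h₀, g₀, smul_eq_mul]
        ring
    · simp [h₁, g₁]
    · simp [h₂, g₂]
  bracket_jacobi := by
    intro i j A B C _ _
    have key : ∀ X Y Z : SL11 k, SL11.bracket k X (SL11.bracket k Y Z) = 0 ∧
        SL11.bracket k (SL11.bracket k X Y) Z = 0 := by
      intro X Y Z
      obtain ⟨_, h₁, h₂⟩ := SL11.bracket_entries Y Z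
      obtain ⟨_, g₁, g₂⟩ := SL11.bracket_entries X Y
      obtain ⟨e₀, e₁, e₂⟩ := SL11.bracket_entries X (SL11.bracket k Y Z)
      obtain ⟨f₀, f₁, f₂⟩ := SL11.bracket_entries (SL11.bracket k X Y) Z
      constructor
      · exact SL11.ext_entries (by simp [e₀, h₁, h₂]) (by simp [e₁]) (by simp [e₂])
      · exact SL11.ext_entries (by simp [f₀, g₁, g₂]) (by simp [f₁]) (by simp [f₂])
    rw [(key A B C).1, (key A B C).2, (key B A C).1]
    simp

end sl11

/-! Write `x`, `y` for the odd generators and `t = [x, y]`. Since `x`, `y` and `x + y` all square to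
zero on M, `t` acts as zero and M is a module over the exterior algebra Λ on `x`, `y`. Λ is
self-dual, and it is projective in ℱ because `t` acts semisimply there. So if `x y` were nonzero on
M, a copy of Λ would split off, and the indecomposable M would be projective
(`isProjectiveInF_of_X_Y_ne_zero`). Hence `x y = y x = 0`, and indecomposability forces the top of M
into one parity p (`exists_parity_killed`). What remains is a Kronecker module: two maps from M_p to
M_{p+1}.

If both parities of trivial summands occur, every `x - s y` has a kernel on M_p. Kronecker's
reduction then splits off a block on which the pencil is surjective
(`exists_idempotent_of_pencil_not_injective`). This block is all of M, so `x` maps onto M_{p+1},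
which leaves no trivial summand there.

If no trivial summand occurs, `y` and all `x - s y` are bijective from M_p to M_{p+1}, yet `y⁻¹ x`
has an eigenvalue s (`false_of_forall_ker_le_range`). -/

section pencil

/-! ### Singular pencils of linear maps (Kronecker's reduction) -/

variable {k : Type*} [Field k] {V W : Type*} [AddCommGroup V] [Module k V]
  [AddCommGroup W] [Module k W]

/-- The sequence `v` is the coefficient sequence of a polynomial vector of degree at most `d` in
the kernel of the pencil `x - s y`. -/
structure IsKernelChain (x y : V →ₗ[k] W) (d : ℕ) (v : ℕ → V) : Prop where
  zero : x (v 0) = 0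
  succ : ∀ i, x (v (i + 1)) = y (v i)
  bound : ∀ i, d < i → v i = 0

/-- A dimension count: with n = dim V, the polynomial vectors of degree at most n are too many to
avoid the kernel at n + 2 points. Applying the pencil to one gives degree at most n + 1, so
vanishing at n + 2 points is vanishing identically. Characteristic zero makes the integers 0, ..., n
+ 1 distinct points. -/
theorem exists_isKernelChain [CharZero k] [FiniteDimensional k V] (x y : V →ₗ[k] W)
    (h : ∀ s : k, ∃ v, v ≠ 0 ∧ x v = s • y v) :
    ∃ d v, v ≠ 0 ∧ IsKernelChain x y d v := by
  set n := Module.finrank k V with hn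
  let A : ℕ → V →ₗ[k] W := fun j => x - (j : k) • y
  let Ψ : (Fin (n + 1) → V) →ₗ[k] ((j : Fin (n + 2)) → LinearMap.range (A j)) :=
    LinearMap.pi fun j => (A j).rangeRestrict ∘ₗ
      ∑ i : Fin (n + 1), ((j : ℕ) : k) ^ (i : ℕ) • LinearMap.proj i
  have hlt : ∀ j, Module.finrank k (LinearMap.range (A j)) + 1 ≤ n := by
    intro j
    obtain ⟨v, hv, hxv⟩ := h j
    have hk : 0 < Module.finrank k (LinearMap.ker (A j)) := by
      rw [Module.finrank_pos_iff_exists_ne_zero]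
      exact ⟨⟨v, by simp [A, hxv]⟩, by simpa [Subtype.ext_iff] using hv⟩
    have := (A j).finrank_range_add_finrank_ker
    omega
  have hker : LinearMap.ker Ψ ≠ ⊥ := by
    apply LinearMap.ker_ne_bot_of_finrank_lt
    rw [Module.finrank_pi_fintype, Module.finrank_pi_fintype]
    have h1 : ∑ j : Fin (n + 2), (Module.finrank k (LinearMap.range (A j))) ≤
        ∑ j : Fin (n + 2), (n - 1) :=
      Finset.sum_le_sum fun j _ => by have := hlt j; omega
    have h0 := hlt 0
    -- The count is (n + 2)(n - 1) = n² + n - 2 < (n + 1) n.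
    refine lt_of_le_of_lt h1 ?_
    simp only [Finset.sum_const, Finset.card_univ, Fintype.card_fin, smul_eq_mul, ← hn]
    obtain ⟨m, hm⟩ : ∃ m, n = m + 1 := ⟨n - 1, by omega⟩
    rw [hm]
    simp only [Nat.add_sub_cancel]
    nlinarith
  obtain ⟨u, hu, hu0⟩ := Submodule.exists_mem_ne_zero_of_ne_bot hker
  let v : ℕ → V := fun i => if hi : i < n + 1 then u ⟨i, hi⟩ else 0
  have hv0 : ∀ i, n < i → v i = 0 := fun i hi => by
    simp only [v]
    rw [dif_neg (by omega)]
  -- The coefficients of (x - s y)(∑ sⁱ vᵢ) as a polynomial in s.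
  let c : ℕ → W := fun i => i.casesOn (x (v 0)) fun i => x (v (i + 1)) - y (v i)
  have hsum : ∀ j : Fin (n + 2), ∑ i ∈ Finset.range (n + 2), ((j : ℕ) : k) ^ i • c i = 0 := by
    intro j
    have e := congrArg Subtype.val (congrFun (LinearMap.mem_ker.1 hu) j)
    have e2 : A j (∑ i ∈ Finset.range (n + 1), ((j : ℕ) : k) ^ i • v i) = 0 := by
      rw [Finset.sum_range]
      simp only [v, Fin.is_lt, dite_true]
      simpa [Ψ] using e
    rw [Finset.sum_range_succ']
    have e3 : ∑ i ∈ Finset.range (n + 2), ((j : ℕ) : k) ^ i • v i =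
      ∑ i ∈ Finset.range (n + 1), ((j : ℕ) : k) ^ i • v i := by
      rw [Finset.sum_range_succ, hv0 (n + 1) (by omega), smul_zero, add_zero]
    have e4 : A j (∑ i ∈ Finset.range (n + 1), ((j : ℕ) : k) ^ i • v i) =
        x (∑ i ∈ Finset.range (n + 2), ((j : ℕ) : k) ^ i • v i) -
        ((j : ℕ) : k) • y (∑ i ∈ Finset.range (n + 1), ((j : ℕ) : k) ^ i • v i) := by
      rw [e3]; rfl
    rw [e4, Finset.sum_range_succ'] at e2
    rw [← e2]
    simp only [c, map_add, map_sum, map_smul, smul_sub, Finset.sum_sub_distrib, Finset.smul_sum,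
      smul_smul, pow_succ']
    abel
  -- Vandermonde, tested against each linear functional on W.
  have hc : ∀ i, i < n + 2 → c i = 0 := by
    intro i hi
    rw [← Module.forall_dual_apply_eq_zero_iff k]
    intro φ
    have key := Matrix.eq_zero_of_forall_index_sum_pow_mul_eq_zero (R := k)
      (f := fun j : Fin (n + 2) => ((j : ℕ) : k)) (v := fun i : Fin (n + 2) => φ (c i))
      (fun a b hab => Fin.ext (Nat.cast_injective (R := k) hab)) (by
        intro j
        have := congrArg φ (hsum j)
        rw [Finset.sum_range] at this
        simpa using this)
    exact congrFun key ⟨i, hi⟩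
  refine ⟨n, v, ?_, ?_, ?_, hv0⟩
  · intro hv
    apply hu0
    ext i
    have := congrFun hv i
    simpa only [v, Fin.is_lt, dite_true, Pi.zero_apply] using this
  · exact hc 0 (by omega)
  · intro i
    by_cases hi : i + 1 < n + 2
    · exact sub_eq_zero.1 (hc (i + 1) hi)
    · rw [hv0 i (by omega), hv0 (i + 1) (by omega), map_zero, map_zero]

/-- A pencil of linear maps with a nonzero kernel at every point has a nonzero idempotent
endomorphism on the image of which the pencil is surjective. -/
theorem exists_idempotent_of_pencil_not_injective [CharZero k] [FiniteDimensional k V]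
    (x y : V →ₗ[k] W) (h : ∀ s : k, ∃ v, v ≠ 0 ∧ x v = s • y v) :
    ∃ (P : V →ₗ[k] V) (Q : W →ₗ[k] W), P ≠ 0 ∧ (∀ v, P (P v) = P v) ∧ (∀ w, Q (Q w) = Q w) ∧
      (∀ v, x (P v) = Q (x v)) ∧ (∀ v, y (P v) = Q (y v)) ∧ ∀ w, ∃ v, Q w = x v := by
  classical
  -- Minimality of the degree d is what makes the block spanned by the chain a direct summand.
  have hex := exists_isKernelChain x y h
  obtain ⟨v, hv, hch⟩ := Nat.find_spec hex
  have hmin : ∀ e, e < Nat.find hex → ∀ u, IsKernelChain x y e u → u = 0 := fun e he u hu => by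
    by_contra hne
    exact Nat.find_min hex he ⟨u, hne, hu⟩
  generalize Nat.find hex = d at hch hmin
  have hvd : v d ≠ 0 := by
    intro h0
    rcases d with _ | d
    · exact hv (funext fun i => by
        rcases i with _ | i
        · exact h0
        · exact hch.bound _ (by omega))
    · refine hv (hmin d (by omega) v ⟨hch.zero, hch.succ, fun i hi => ?_⟩)
      rcases eq_or_lt_of_le (Nat.succ_le_of_lt hi) with rfl | hi
      · exact h0
      · exact hch.bound _ hi
  rcases d with _ | d
  -- In degree 0 the vector `v 0` is killed by both maps, so its line splits off with zero target.
  · obtain ⟨φ, hφ⟩ : ∃ φ : V →ₗ[k] k, φ (v 0) = 1 := by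
      obtain ⟨F, hF, -⟩ := Submodule.exists_le_ker_of_notMem
        (p := (⊥ : Submodule k V)) (v := v 0) (by simpa using hvd)
      exact ⟨(F (v 0))⁻¹ • F, by simp [hF]⟩
    have hy0 : y (v 0) = 0 := by rw [← hch.succ, hch.bound _ (by omega), map_zero]
    refine ⟨φ.smulRight (v 0), 0, ?_, ?_, ?_, ?_, ?_, fun w => ⟨0, by simp⟩⟩
    · intro h0
      have := LinearMap.congr_fun h0 (v 0)
      simp [hφ, hvd] at this
    all_goals simp [hφ, hy0, hch.zero]
  -- The chain now has degree d + 1. S is the image under the pencil of the polynomial vectors of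
  -- degree less than d.
  · let S : Submodule k (ℕ → W) :=
      { carrier := {w | ∃ u : ℕ → V, (∀ i, d ≤ i → u i = 0) ∧ w 0 = x (u 0) ∧
          ∀ i, w (i + 1) = x (u (i + 1)) - y (u i)}
        add_mem' := by
          rintro a b ⟨u, hu, hu0, hus⟩ ⟨u', hu', hu0', hus'⟩
          refine ⟨u + u', fun i hi => by simp [hu i hi, hu' i hi], by simp [hu0, hu0'],
            fun i => ?_⟩
          simp only [Pi.add_apply, hus, hus', map_add]
          abel
        zero_mem' := ⟨0, by simp⟩
        smul_mem' := by
          rintro c a ⟨u, hu, hu0, hus⟩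
          exact ⟨c • u, fun i hi => by simp [hu i hi], by simp [hu0],
            fun i => by simp [hus, smul_sub]⟩ }
    have hnot : (Pi.single 0 (y (v 0)) : ℕ → W) ∉ S := by
      rintro ⟨u, hu, hu0, hus⟩
      -- If the constant `y (v 0)` came from u, the shifted chain minus u would be a kernel chain of
      -- degree d whose d-th term is `v (d + 1) ≠ 0`.
      have hz := hmin d (by omega) (fun i => v (i + 1) - u i) ⟨?_, ?_, ?_⟩
      · have := congrFun hz d
        simp only [hu d le_rfl, sub_zero, Pi.zero_apply] at this
        exact hvd this
      · rw [Pi.single_eq_same] at hu0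
        rw [map_sub, hch.succ, hu0, sub_self]
      · intro i
        have h1 := hus i
        rw [Pi.single_eq_of_ne (by omega)] at h1
        rw [map_sub, map_sub, hch.succ, sub_eq_sub_iff_sub_eq_sub, sub_self]
        exact h1
      · intro i hi
        rw [hch.bound _ (by omega), hu _ hi.le, sub_zero]
    obtain ⟨F, hF1, hFS⟩ : ∃ F : (ℕ → W) →ₗ[k] k, F (Pi.single 0 (y (v 0))) = 1 ∧
        ∀ w ∈ S, F w = 0 := by
      obtain ⟨F, hF, hS⟩ := Submodule.exists_le_ker_of_notMem hnot
      refine ⟨(F (Pi.single 0 (y (v 0))))⁻¹ • F, ?_, fun w hw => ?_⟩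
      · simp [hF]
      · simp [LinearMap.mem_ker.1 (hS hw)]
    -- The components of F form a dual chain: vanishing on S says `q (i + 1) ∘ y = q i ∘ x` for i <
    -- d, which makes `q i` dual to `y (v j)`.
    let q : ℕ → W →ₗ[k] k := fun i => F ∘ₗ LinearMap.single k (fun _ => W) i
    have hq1 : q 0 (y (v 0)) = 1 := hF1
    have hq : ∀ i, i < d → ∀ a, q (i + 1) (y a) = q i (x a) := by
      intro i hi a
      have hmem : (Pi.single i (x a) - Pi.single (i + 1) (y a) : ℕ → W) ∈ S := by
        refine ⟨Pi.single i a, fun j hj => Pi.single_eq_of_ne (by omega) _, ?_, fun j => ?_⟩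
        · rcases i with _ | i
          · simp
          · simp [Pi.single_eq_of_ne]
        · by_cases h1 : i = j
          · subst h1
            simp [Pi.single_eq_of_ne]
          · by_cases h2 : i = j + 1
            · subst h2
              simp [Pi.single_eq_of_ne]
            · simp [Pi.single_eq_of_ne, Ne.symm h1, Ne.symm h2]
      have := hFS _ hmem
      rw [map_sub, sub_eq_zero] at this
      exact this.symm
    have hshift : ∀ i, i < d → ∀ j, q (i + 1) (y (v (j + 1))) = q i (y (v j)) := fun i hi j => by
      rw [hq i hi, hch.succ]
    have hlow : ∀ i, i < d → q (i + 1) (y (v 0)) = 0 := fun i hi => by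
      rw [hq i hi, hch.zero, map_zero]
    -- Shift both indices up until i = d; then j > d and `y (v j) = x (v (j + 1)) = 0`.
    have hup : ∀ i j, i ≤ d → i < j → q i (y (v j)) = 0 := by
      intro i j hi hij
      induction hm : d - i generalizing i j with
      | zero =>
        rw [← hch.succ, hch.bound _ (by omega), map_zero, map_zero]
      | succ m ih =>
        rw [← hshift i (by omega)]
        exact ih _ _ (by omega) (by omega) (by omega)
    have hdelta : ∀ i j, i ≤ d → q i (y (v j)) = if i = j then 1 else 0 := by
      intro i j hi
      induction i generalizing j with
      | zero =>
        rcases j with _ | j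
        · simpa using hq1
        · rw [hup 0 _ hi (by omega)]; simp
      | succ i ih =>
        rcases j with _ | j
        · rw [hlow i (by omega)]; simp
        · rw [hshift i (by omega), ih j (by omega)]; simp
    -- P and Q project onto the spans of v₀, ..., v_{d+1} and of y v₀, ..., y v_d. The functional
    -- dual to `v (i + 1)` is `q i ∘ x`; only `v 0`, killed by `x`, needs `y` instead.
    let P : V →ₗ[k] V := (q 0 ∘ₗ y).smulRight (v 0) +
      ∑ i ∈ Finset.range (d + 1), (q i ∘ₗ x).smulRight (v (i + 1))
    let Q : W →ₗ[k] W := ∑ i ∈ Finset.range (d + 1), (q i).smulRight (y (v i))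
    have hP : ∀ a, P a = q 0 (y a) • v 0 + ∑ i ∈ Finset.range (d + 1), q i (x a) • v (i + 1) := by
      intro a; simp [P]
    have hQ : ∀ w, Q w = ∑ i ∈ Finset.range (d + 1), q i w • y (v i) := by
      intro a; simp [Q]
    have hQy : ∀ j, Q (y (v j)) = y (v j) := by
      intro j
      rw [hQ]
      by_cases hj : j < d + 1
      · rw [Finset.sum_eq_single j]
        · rw [hdelta j j (by omega)]; simp
        · intro b hb hbj
          rw [hdelta b j (by have := Finset.mem_range.1 hb; omega), if_neg hbj, zero_smul]
        · intro hj'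
          exact absurd (Finset.mem_range.2 hj) hj'
      · have : y (v j) = 0 := by rw [← hch.succ, hch.bound _ (by omega), map_zero]
        simp [this]
    have hPv : ∀ j, P (v j) = v j := by
      intro j
      rw [hP]
      rcases j with _ | j
      · simp [hch.zero, hq1]
      · rw [hdelta 0 _ (by omega), if_neg (by omega), zero_smul, zero_add]
        by_cases hj : j < d + 1
        · rw [Finset.sum_eq_single j]
          · rw [hch.succ, hdelta j j (by omega)]; simp
          · intro b hb hbj
            rw [hch.succ, hdelta b j (by have := Finset.mem_range.1 hb; omega), if_neg hbj,
              zero_smul]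
          · intro hj'
            exact absurd (Finset.mem_range.2 hj) hj'
        · simp [hch.bound (j + 1) (by omega)]
    refine ⟨P, Q, ?_, ?_, ?_, ?_, ?_, ?_⟩
    · intro h0
      have := hPv (d + 1)
      rw [h0, LinearMap.zero_apply] at this
      exact hvd this.symm
    · intro a
      conv_lhs => rw [hP a]
      simp only [map_add, map_sum, map_smul, hPv]
      rw [hP a]
    · intro a
      conv_lhs => rw [hQ a]
      simp only [map_sum, map_smul, hQy]
      rw [hQ a]
    · intro a
      rw [hP, hQ]
      simp only [map_add, map_sum, map_smul, hch.zero, hch.succ, smul_zero, zero_add]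
    · intro a
      have h0 : y (v (d + 1)) = 0 := by rw [← hch.succ, hch.bound _ (by omega), map_zero]
      rw [hP, hQ, Finset.sum_range_succ, Finset.sum_range_succ' (fun i => q i (y a) • y (v i))]
      simp only [map_add, map_sum, map_smul, h0, smul_zero, add_zero]
      rw [add_comm]
      congr 1
      refine Finset.sum_congr rfl fun i hi => ?_
      rw [hq i (Finset.mem_range.1 hi)]
    · intro w
      refine ⟨∑ i ∈ Finset.range (d + 1), q i w • v (i + 1), ?_⟩
      rw [hQ]
      simp only [map_sum, map_smul, hch.succ]

end pencil
theorem ZMod.two_add_one_add_one (p : ZMod 2) : p + 1 + 1 = p := by revert p; decide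

theorem ZMod.two_eq_zero_or_eq_one (p : ZMod 2) : p = 0 ∨ p = 1 := by revert p; decide

theorem ZMod.two_eq_or_eq_add_one (i p : ZMod 2) : i = p ∨ i = p + 1 := by revert i p; decide

/-! ### Generators of 𝔰𝔩(1|1) and their relations on a supermodule -/

namespace SL11

section generators

variable (k : Type*) [Field k]

/-- The central even generator of `𝔰𝔩(1|1)`. -/
def t : SL11 k := ⟨!![1, 0; 0, 1], by simp [supertrace11]⟩

/-- The upper triangular odd generator of `𝔰𝔩(1|1)`. -/
def x : SL11 k := ⟨!![0, 1; 0, 0], by simp [supertrace11]⟩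

/-- The lower triangular odd generator of `𝔰𝔩(1|1)`. -/
def y : SL11 k := ⟨!![0, 0; 1, 0], by simp [supertrace11]⟩

variable {k}

theorem t_mem : t k ∈ superPart k (SL11 k) 0 := (mem_even _).2 (by simp [t])

theorem x_mem : x k ∈ superPart k (SL11 k) 1 := (mem_odd _).2 (by simp [x])

theorem y_mem : y k ∈ superPart k (SL11 k) 1 := (mem_odd _).2 (by simp [y])

theorem eq_smul_add (a : SL11 k) : a = a.1 0 0 • t k + a.1 0 1 • x k + a.1 1 0 • y k := by
  apply ext_entries <;> simp [t, x, y]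

theorem bracket_x_x : LieSuperalgebra.bracket (k := k) (x k) (x k) = 0 := by
  change SL11.bracket k _ _ = _
  obtain ⟨h0, h1, h2⟩ := bracket_entries (x k) (x k)
  apply ext_entries <;> simp only [h0, h1, h2] <;> simp [x]

theorem bracket_y_y : LieSuperalgebra.bracket (k := k) (y k) (y k) = 0 := by
  change SL11.bracket k _ _ = _
  obtain ⟨h0, h1, h2⟩ := bracket_entries (y k) (y k)
  apply ext_entries <;> simp only [h0, h1, h2] <;> simp [y]

theorem bracket_x_y : LieSuperalgebra.bracket (k := k) (x k) (y k) = t k := by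
  change SL11.bracket k _ _ = _
  obtain ⟨h0, h1, h2⟩ := bracket_entries (x k) (y k)
  apply ext_entries <;> simp [h0, h1, h2] <;> simp [x, y, t]

end generators

section modules

variable (k : Type*) [Field k] (N : Type*) [AddCommGroup N] [Module k N]
  [LieSupermodule k (SL11 k) N]

/-- The action of `t`. -/
def T : Module.End k N := superAct k (SL11 k) N (t k)

/-- The action of `x`. -/
def X : Module.End k N := superAct k (SL11 k) N (x k)

/-- The action of `y`. -/
def Y : Module.End k N := superAct k (SL11 k) N (y k)

variable {N}

theorem act_eq (a : SL11 k) (n : N) :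
    superAct k (SL11 k) N a n = a.1 0 0 • T k N n + a.1 0 1 • X k N n + a.1 1 0 • Y k N n := by
  conv_lhs => rw [eq_smul_add a]
  simp [T, X, Y, superAct]

theorem X_mem {i : ZMod 2} {n : N} (hn : n ∈ modPart k (SL11 k) N i) :
    X k N n ∈ modPart k (SL11 k) N (i + 1) := by
  rw [add_comm]
  exact LieSupermodule.act_mem x_mem hn

theorem Y_mem {i : ZMod 2} {n : N} (hn : n ∈ modPart k (SL11 k) N i) :
    Y k N n ∈ modPart k (SL11 k) N (i + 1) := by
  rw [add_comm]
  exact LieSupermodule.act_mem y_mem hn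

theorem X_Y_mem {i : ZMod 2} {n : N} (hn : n ∈ modPart k (SL11 k) N i) :
    X k N (Y k N n) ∈ modPart k (SL11 k) N i := by
  simpa only [ZMod.two_add_one_add_one] using X_mem k (Y_mem k hn)

theorem act_bracket_odd {a b : SL11 k} (ha : a ∈ superPart k (SL11 k) 1)
    (hb : b ∈ superPart k (SL11 k) 1) (n : N) :
    superAct k (SL11 k) N (LieSuperalgebra.bracket (k := k) a b) n =
      superAct k (SL11 k) N a (superAct k (SL11 k) N b n) +
        superAct k (SL11 k) N b (superAct k (SL11 k) N a n) := by
  have hs : superSign k (1 : ZMod 2) 1 = -1 := by simp [superSign, ZMod.val_one]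
  have := LieSupermodule.act_bracket n ha hb
  rw [hs, neg_one_smul, sub_neg_eq_add] at this
  exact this

theorem X_Y_add_Y_X (n : N) : X k N (Y k N n) + Y k N (X k N n) = T k N n := by
  have := act_bracket_odd k x_mem y_mem n
  rw [bracket_x_y] at this
  exact this.symm

theorem X_X [CharZero k] (n : N) : X k N (X k N n) = 0 := by
  have := act_bracket_odd k x_mem x_mem n
  rw [bracket_x_x, superAct, map_zero, LinearMap.zero_apply, ← two_smul k] at this
  exact (smul_eq_zero.1 this.symm).resolve_left two_ne_zero

theorem Y_Y [CharZero k] (n : N) : Y k N (Y k N n) = 0 := by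
  have := act_bracket_odd k y_mem y_mem n
  rw [bracket_y_y, superAct, map_zero, LinearMap.zero_apply, ← two_smul k] at this
  exact (smul_eq_zero.1 this.symm).resolve_left two_ne_zero

theorem Y_X_of_T {n : N} (hn : T k N n = 0) : Y k N (X k N n) = - X k N (Y k N n) := by
  rw [eq_neg_iff_add_eq_zero, add_comm, X_Y_add_Y_X, hn]

/-- The odd elements generate: `t` acts as `x y + y x`. -/
theorem isSupermoduleHom_of_comm {N' : Type*} [AddCommGroup N'] [Module k N']
    [LieSupermodule k (SL11 k) N'] (f : N →ₗ[k] N')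
    (hf : ∀ i, ∀ m ∈ modPart k (SL11 k) N i, f m ∈ modPart k (SL11 k) N' i)
    (hX : ∀ m, f (X k N m) = X k N' (f m)) (hY : ∀ m, f (Y k N m) = Y k N' (f m)) :
    IsSupermoduleHom k (SL11 k) f := by
  refine ⟨hf, fun a m => ?_⟩
  have hT : f (T k N m) = T k N' (f m) := by
    rw [← X_Y_add_Y_X, ← X_Y_add_Y_X, map_add, hX, hY, hY, hX]
  rw [act_eq, act_eq]
  simp [hX, hY, hT]

end modules

end SL11

/-! ### Parity projections, indecomposability and lifting in ℱ -/

section graded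

variable (k : Type*) (L : Type*) [Field k] [AddCommGroup L] [Module k L] [LieSuperalgebra k L]
  {N : Type*} [AddCommGroup N] [Module k N] [LieSupermodule k L N]

variable (N) in
theorem isCompl_modPart (p : ZMod 2) : IsCompl (modPart k L N p) (modPart k L N (p + 1)) := by
  obtain rfl | rfl := ZMod.two_eq_zero_or_eq_one p
  · exact SuperVectorSpace.isCompl_part
  · exact SuperVectorSpace.isCompl_part.symm

variable (N) in
/-- The projection of a supermodule onto its homogeneous component of parity `p`. -/
noncomputable def parityProj (p : ZMod 2) : N →ₗ[k] N :=
  (modPart k L N p).projection _ (isCompl_modPart k L N p)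

theorem parityProj_mem (p : ZMod 2) (n : N) : parityProj k L N p n ∈ modPart k L N p :=
  Submodule.projection_apply_mem _ _

theorem sub_parityProj_mem (p : ZMod 2) (n : N) :
    n - parityProj k L N p n ∈ modPart k L N (p + 1) :=
  Submodule.sub_projection_mem _ _

theorem parityProj_of_mem {p : ZMod 2} {n : N} (hn : n ∈ modPart k L N p) :
    parityProj k L N p n = n :=
  Submodule.projection_apply_of_mem_left _ hn

theorem parityProj_of_mem_add_one {p : ZMod 2} {n : N} (hn : n ∈ modPart k L N (p + 1)) :
    parityProj k L N p n = 0 :=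
  (Submodule.projection_apply_eq_zero_iff _).2 hn

theorem exists_homogeneous_add (p : ZMod 2) (n : N) :
    ∃ a ∈ modPart k L N p, ∃ b ∈ modPart k L N (p + 1), n = a + b :=
  ⟨_, parityProj_mem k L p n, _, sub_parityProj_mem k L p n, by abel⟩

theorem eq_zero_of_mem_of_mem {p : ZMod 2} {n : N} (h : n ∈ modPart k L N p)
    (h' : n ∈ modPart k L N (p + 1)) : n = 0 := by
  rw [← parityProj_of_mem k L h, parityProj_of_mem_add_one k L h']

theorem isGradedSubspace_of_proj_mem {W : Submodule k N}
    (h : ∀ w ∈ W, parityProj k L N 0 w ∈ W) : IsGradedSubspace k L W := by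
  refine le_antisymm (fun w hw => ?_) (sup_le inf_le_left inf_le_left)
  exact Submodule.mem_sup.2 ⟨_, ⟨h w hw, parityProj_mem k L 0 w⟩, _,
    ⟨W.sub_mem hw (h w hw), sub_parityProj_mem k L 0 w⟩, by abel⟩

theorem IsGradedSubspace.exists_homogeneous_add {W : Submodule k N} (hW : IsGradedSubspace k L W)
    (p : ZMod 2) {w : N} (hw : w ∈ W) :
    ∃ a ∈ W, a ∈ modPart k L N p ∧ ∃ b ∈ W, b ∈ modPart k L N (p + 1) ∧ w = a + b := by
  rw [hW] at hw
  obtain ⟨a, ha, b, hb, rfl⟩ := Submodule.mem_sup.1 hw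
  obtain rfl | rfl := ZMod.two_eq_zero_or_eq_one p
  · exact ⟨a, ha.1, ha.2, b, hb.1, hb.2, rfl⟩
  · exact ⟨b, hb.1, hb.2, a, ha.1, ha.2, add_comm _ _⟩

variable {N' : Type*} [AddCommGroup N'] [Module k N'] [LieSupermodule k L N']

theorem IsSupermoduleHom.parityProj_comm {f : N →ₗ[k] N'} (hf : IsSupermoduleHom k L f)
    (p : ZMod 2) (n : N) : f (parityProj k L N p n) = parityProj k L N' p (f n) := by
  obtain ⟨a, ha, b, hb, rfl⟩ := _root_.exists_homogeneous_add k L p n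
  simp [parityProj_of_mem k L ha, parityProj_of_mem_add_one k L hb,
    parityProj_of_mem k L (hf.1 _ _ ha), parityProj_of_mem_add_one k L (hf.1 _ _ hb)]

theorem IsSupermoduleHom.isSubsupermodule_ker {f : N →ₗ[k] N'} (hf : IsSupermoduleHom k L f) :
    IsSubsupermodule k L (LinearMap.ker f) := by
  refine ⟨isGradedSubspace_of_proj_mem k L fun w hw => ?_, fun a m hm => ?_⟩
  · rw [LinearMap.mem_ker, hf.parityProj_comm, LinearMap.mem_ker.1 hw, map_zero]
  · rw [LinearMap.mem_ker, hf.2, LinearMap.mem_ker.1 hm, map_zero]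

theorem IsSupermoduleHom.isSubsupermodule_range {f : N →ₗ[k] N'} (hf : IsSupermoduleHom k L f) :
    IsSubsupermodule k L (LinearMap.range f) := by
  refine ⟨isGradedSubspace_of_proj_mem k L ?_, ?_⟩
  · rintro _ ⟨n, rfl⟩
    exact ⟨_, hf.parityProj_comm k L 0 n⟩
  · rintro a _ ⟨n, rfl⟩
    exact ⟨_, hf.2 a n⟩

/-- Range and kernel of an idempotent morphism are complementary sub-supermodules. All later uses of
indecomposability go through this form. -/
theorem IsIndecomposableSupermodule.eq_zero_or_eq_id (hN : IsIndecomposableSupermodule k L N)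
    {E : N →ₗ[k] N} (hE : IsSupermoduleHom k L E) (hidem : ∀ n, E (E n) = E n) :
    E = 0 ∨ ∀ n, E n = n := by
  have hc : IsCompl (LinearMap.range E) (LinearMap.ker E) :=
    LinearMap.IsIdempotentElem.isCompl (LinearMap.ext hidem)
  rcases hN.2 _ _ (hE.isSubsupermodule_range) (hE.isSubsupermodule_ker) hc with h | h
  · exact .inl (LinearMap.range_eq_bot.1 h)
  · refine .inr fun n => ?_
    have : E n - n ∈ LinearMap.ker E := by simp [hidem]
    rw [h, Submodule.mem_bot] at this
    exact sub_eq_zero.1 this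

/-- A homogeneous element of a quotient of a module in `ℱ` has a homogeneous preimage which is
killed by every even element that kills it. -/
theorem InCategoryF.exists_lift (hN : InCategoryF k L N) {f : N →ₗ[k] N'}
    (hf : IsSupermoduleHom k L f) (hsurj : Function.Surjective f) {p : ZMod 2} {m : N'}
    (hm : m ∈ modPart k L N' p) :
    ∃ n ∈ modPart k L N p, f n = m ∧
      ∀ a ∈ superPart k L 0, superAct k L N' a m = 0 → superAct k L N a n = 0 := by
  have hk := hf.isSubsupermodule_ker
  obtain ⟨C, hC, hcompl⟩ := hN.completelyReducible _ ⟨hk.1, fun a _ => hk.2 a⟩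
  obtain ⟨n, rfl⟩ := hsurj m
  obtain ⟨c, hc, e, he, rfl⟩ : ∃ c ∈ C, ∃ e ∈ LinearMap.ker f, e + c = n := by
    have : n ∈ LinearMap.ker f ⊔ C := by rw [hcompl.sup_eq_top]; trivial
    obtain ⟨e, he, c, hc, h⟩ := Submodule.mem_sup.1 this
    exact ⟨c, hc, e, he, h⟩
  rw [map_add, LinearMap.mem_ker.1 he, zero_add] at hm ⊢
  obtain ⟨a, haC, ha, b, hbC, hb, rfl⟩ := hC.1.exists_homogeneous_add k L p hc
  have hfa : f a = f (a + b) := by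
    have h1 := hf.parityProj_comm k L p (a + b)
    rwa [parityProj_of_mem k L hm, map_add, parityProj_of_mem k L ha,
      parityProj_of_mem_add_one k L hb, add_zero] at h1
  -- The lift lies in an even-stable complement C of the kernel; if z kills its image, then z times
  -- the lift lies in both C and the kernel.
  refine ⟨a, ha, hfa, fun z hz hz0 => ?_⟩
  rw [← hfa, ← hf.2] at hz0
  exact Submodule.disjoint_def.1 hcompl.disjoint _ hz0 (hC.2 z hz a haC)

end graded

/-! ### Self-duality of the exterior algebra and projectivity -/

namespace SL11

section free

variable (k : Type*) [Field k] {M : Type*} [AddCommGroup M] [Module k M]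
  [LieSupermodule k (SL11 k) M] {N : Type*} [AddCommGroup N] [Module k N]
  [LieSupermodule k (SL11 k) N]

/-- The map to a cyclic module with generator `n` which is determined by a linear functional, by
self-duality of the exterior algebra on `x` and `y`. -/
def functionalHom (φ : M →ₗ[k] k) (n : N) : M →ₗ[k] N :=
  (φ ∘ₗ X k M ∘ₗ Y k M).smulRight n - (φ ∘ₗ Y k M).smulRight (X k N n) +
    (φ ∘ₗ X k M).smulRight (Y k N n) + φ.smulRight (X k N (Y k N n))

theorem functionalHom_apply (φ : M →ₗ[k] k) (n : N) (w : M) :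
    functionalHom k φ n w = φ (X k M (Y k M w)) • n - φ (Y k M w) • X k N n +
      φ (X k M w) • Y k N n + φ w • X k N (Y k N n) := rfl

/-- With `t = 0` on M and on n, the signs in the four coefficients match the relation `y x = - x y`.
As φ lives on the parity p of n, the map is even. -/
theorem isSupermoduleHom_functionalHom [CharZero k] (hT : ∀ m : M, T k M m = 0) {p : ZMod 2}
    {φ : M →ₗ[k] k} (hφ : ∀ m ∈ modPart k (SL11 k) M (p + 1), φ m = 0) {n : N}
    (hn : n ∈ modPart k (SL11 k) N p) (hTn : T k N n = 0) :
    IsSupermoduleHom k (SL11 k) (functionalHom k φ n) := by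
  have hYX : ∀ m : M, Y k M (X k M m) = - X k M (Y k M m) := fun m => Y_X_of_T k (hT m)
  have hYXn := Y_X_of_T k hTn
  have hYXYn : Y k N (X k N (Y k N n)) = 0 := by
    rw [← neg_eq_iff_eq_neg.2 hYXn, map_neg, Y_Y, neg_zero]
  have hXYn : X k N (Y k N n) ∈ modPart k (SL11 k) N p := X_Y_mem k hn
  refine isSupermoduleHom_of_comm k _ (fun i m hm => ?_) (fun m => ?_) (fun m => ?_)
  · rw [functionalHom_apply]
    obtain rfl | rfl := ZMod.two_eq_or_eq_add_one i p
    · rw [hφ _ (Y_mem k hm), hφ _ (X_mem k hm), zero_smul, zero_smul, sub_zero, add_zero]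
      exact add_mem (Submodule.smul_mem _ _ hn) (Submodule.smul_mem _ _ hXYn)
    · rw [hφ _ hm, hφ _ (X_Y_mem k hm),
        zero_smul, zero_smul, zero_sub, add_zero]
      exact add_mem (neg_mem (Submodule.smul_mem _ _ (X_mem k hn)))
        (Submodule.smul_mem _ _ (Y_mem k hn))
  · simp [functionalHom_apply, hYX, X_X]
  · simp [functionalHom_apply, Y_Y, hYXn, hYXYn]

end free

/-- An indecomposable module in `ℱ` on which `t` acts as zero and `x y` does not is projective. -/
theorem isProjectiveInF_of_X_Y_ne_zero (k : Type u) [Field k] [CharZero k] {M : Type v}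
    [AddCommGroup M] [Module k M] [LieSupermodule k (SL11 k) M] (hF : InCategoryF k (SL11 k) M)
    (hindec : IsIndecomposableSupermodule k (SL11 k) M) (hT : ∀ m : M, T k M m = 0)
    {p : ZMod 2} {m : M} (hm : m ∈ modPart k (SL11 k) M p) (hXY : X k M (Y k M m) ≠ 0) :
    IsProjectiveInF k (SL11 k) M := by
  have hYX : ∀ m : M, Y k M (X k M m) = - X k M (Y k M m) := fun m => Y_X_of_T k (hT m)
  have hXYm : X k M (Y k M m) ∈ modPart k (SL11 k) M p := X_Y_mem k hm
  obtain ⟨F, hF0⟩ : ∃ F : M →ₗ[k] k, F (X k M (Y k M m)) ≠ 0 := by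
    by_contra! h
    exact hXY ((Module.forall_dual_apply_eq_zero_iff k _).1 h)
  set G : M →ₗ[k] k := (F (X k M (Y k M m)))⁻¹ • F ∘ₗ parityProj k (SL11 k) M p with hG
  have hG1 : G (X k M (Y k M m)) = 1 := by simp [G, parityProj_of_mem k _ hXYm, hF0]
  have hGp : ∀ a ∈ modPart k (SL11 k) M (p + 1), G a = 0 := fun a ha => by
    simp [G, parityProj_of_mem_add_one k _ ha]
  clear_value G
  -- The correction achieves φ(m) = 0 and keeps φ(x y m) = 1, because x y x y = 0. The map sending w
  -- to its cyclic image then fixes m, so it is idempotent and, by indecomposability, the identity.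
  let φ : M →ₗ[k] k := G - G m • (G ∘ₗ X k M ∘ₗ Y k M)
  have hφ : ∀ a, φ a = G a - G m * G (X k M (Y k M a)) := fun a => rfl
  have hφ1 : φ (X k M (Y k M m)) = 1 := by simp [hφ, hYX, X_X, hG1]
  have hφ0 : φ m = 0 := by simp [hφ, hG1]
  have hφp : ∀ a ∈ modPart k (SL11 k) M (p + 1), φ a = 0 := fun a ha => by
    rw [hφ, hGp a ha, hGp _ (X_Y_mem k ha), mul_zero, sub_zero]
  clear_value φ
  have hE := isSupermoduleHom_functionalHom k hT hφp hm (hT m)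
  have hEm : functionalHom k φ m m = m := by
    rw [functionalHom_apply, hφ1, hφ0, hφp _ (X_mem k hm), hφp _ (Y_mem k hm)]
    simp
  have hEX : ∀ a, functionalHom k φ m (X k M a) = X k M (functionalHom k φ m a) := hE.2 _
  have hEY : ∀ a, functionalHom k φ m (Y k M a) = Y k M (functionalHom k φ m a) := hE.2 _
  have hE1 : ∀ n, functionalHom k φ m n = n := by
    refine (hindec.eq_zero_or_eq_id k _ hE fun n => ?_).resolve_left fun h0 => ?_
    · conv_lhs => rw [functionalHom_apply k φ m n]
      simp only [map_add, map_sub, map_smul, hEX, hEY, hEm]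
      rw [functionalHom_apply]
    · rw [h0, LinearMap.zero_apply] at hEm
      exact hXY (by rw [← hEm, map_zero, map_zero])
  refine ⟨hF, ?_⟩
  intro N N' _ _ _ _ _ _ hN _ f g hf hsurj hg
  -- M is generated by m, so only the image of m has to be lifted, to an element still killed by
  -- `t`.
  obtain ⟨n, hn, hfn, hT'⟩ := hN.exists_lift k _ hf hsurj (hg.1 p m hm)
  have hTn : T k N n = 0 :=
    hT' _ t_mem (by rw [← hg.2]; exact (congrArg g (hT m)).trans (map_zero g))
  refine ⟨functionalHom k φ n, isSupermoduleHom_functionalHom k hT hφp hn hTn, ?_⟩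
  ext a
  have hfX : ∀ b, f (X k N b) = X k N' (f b) := hf.2 _
  have hfY : ∀ b, f (Y k N b) = Y k N' (f b) := hf.2 _
  have hgX : ∀ b, g (X k M b) = X k N' (g b) := hg.2 _
  have hgY : ∀ b, g (Y k M b) = Y k N' (g b) := hg.2 _
  conv_rhs => rw [← hE1 a]
  simp [functionalHom_apply, hfX, hfY, hgX, hgY, hfn]

/-! ### Modules with radical square zero as Kronecker modules -/

section radical

variable (k : Type*) [Field k] [CharZero k] {M : Type*} [AddCommGroup M] [Module k M]
  [LieSupermodule k (SL11 k) M]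

/-- An indecomposable module with vanishing square of the radical has its top in one parity. -/
theorem exists_parity_killed (hindec : IsIndecomposableSupermodule k (SL11 k) M)
    (hXY : ∀ m : M, X k M (Y k M m) = 0) (hYX : ∀ m : M, Y k M (X k M m) = 0) :
    ∃ p : ZMod 2, ∀ m ∈ modPart k (SL11 k) M (p + 1), X k M m = 0 ∧ Y k M m = 0 := by
  let R : Submodule k M := LinearMap.range (X k M) ⊔ LinearMap.range (Y k M)
  have hXR : ∀ m, X k M m ∈ R := fun m => Submodule.mem_sup_left ⟨m, rfl⟩
  have hYR : ∀ m, Y k M m ∈ R := fun m => Submodule.mem_sup_right ⟨m, rfl⟩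
  have hR : ∀ r ∈ R, X k M r = 0 ∧ Y k M r = 0 := by
    intro r hr
    obtain ⟨_, ⟨a, rfl⟩, _, ⟨b, rfl⟩, rfl⟩ := Submodule.mem_sup.1 hr
    simp [X_X, Y_Y, hXY, hYX]
  have hρ : ∀ p : ZMod 2, ∃ ρ : M →ₗ[k] M, (∀ m, ρ m ∈ R ∧ ρ m ∈ modPart k (SL11 k) M p) ∧
      ∀ r ∈ R, r ∈ modPart k (SL11 k) M p → ρ r = r := by
    intro p
    obtain ⟨D, hD⟩ := (R ⊓ modPart k (SL11 k) M p).exists_isCompl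
    exact ⟨Submodule.projection _ _ hD, fun m =>
      Submodule.mem_inf.1 (Submodule.projection_apply_mem _ _),
      fun r hr hrp => Submodule.projection_apply_of_mem_left _ ⟨hr, hrp⟩⟩
  obtain ⟨ρ₀, hρ₀, hρ₀'⟩ := hρ 0
  obtain ⟨ρ₁, hρ₁, hρ₁'⟩ := hρ 1
  -- E projects onto an even complement of R plus the odd part of R, along the even part of R plus
  -- an odd complement: it separates the summand with even top from the one with odd top.
  let E : M →ₗ[k] M := (LinearMap.id - ρ₀) ∘ₗ parityProj k (SL11 k) M 0 +
    ρ₁ ∘ₗ parityProj k (SL11 k) M 1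
  have hE0 : ∀ m ∈ modPart k (SL11 k) M 0, E m = m - ρ₀ m := fun m hm => by
    have h1 : m ∈ modPart k (SL11 k) M (1 + 1) := hm
    simp [E, parityProj_of_mem k _ hm, parityProj_of_mem_add_one k _ h1]
  have hE1 : ∀ m ∈ modPart k (SL11 k) M 1, E m = ρ₁ m := fun m hm => by
    have h1 : m ∈ modPart k (SL11 k) M (0 + 1) := hm
    simp [E, parityProj_of_mem k _ hm, parityProj_of_mem_add_one k _ h1]
  have hparts : ∀ {P : M → Prop}, (∀ a b, P a → P b → P (a + b)) →
      (∀ m ∈ modPart k (SL11 k) M 0, P m) → (∀ m ∈ modPart k (SL11 k) M 1, P m) → ∀ m, P m := by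
    intro P hadd h0 h1 m
    obtain ⟨a, ha, b, hb, rfl⟩ := exists_homogeneous_add k (SL11 k) 0 m
    exact hadd _ _ (h0 a ha) (h1 b hb)
  have hhom : IsSupermoduleHom k (SL11 k) E := by
    refine isSupermoduleHom_of_comm k _ (fun i m hm => ?_) ?_ ?_
    · obtain rfl | rfl := ZMod.two_eq_zero_or_eq_one i
      · rw [hE0 m hm]
        exact sub_mem hm (hρ₀ m).2
      · rw [hE1 m hm]
        exact (hρ₁ m).2
    · refine hparts (fun a b ha hb => by simp only [map_add, ha, hb]) (fun m hm => ?_)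
        fun m hm => ?_
      · rw [hE0 m hm, hE1 _ (X_mem k hm), hρ₁' _ (hXR m) (X_mem k hm), map_sub,
          (hR _ (hρ₀ m).1).1, sub_zero]
      · rw [hE1 m hm, hE0 _ (X_mem k hm), hρ₀' _ (hXR m) (X_mem k hm), sub_self,
          (hR _ (hρ₁ m).1).1]
    · refine hparts (fun a b ha hb => by simp only [map_add, ha, hb]) (fun m hm => ?_)
        fun m hm => ?_
      · rw [hE0 m hm, hE1 _ (Y_mem k hm), hρ₁' _ (hYR m) (Y_mem k hm), map_sub,
          (hR _ (hρ₀ m).1).2, sub_zero]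
      · rw [hE1 m hm, hE0 _ (Y_mem k hm), hρ₀' _ (hYR m) (Y_mem k hm), sub_self,
          (hR _ (hρ₁ m).1).2]
  have hidem : ∀ m, E (E m) = E m := by
    refine hparts (fun a b ha hb => by simp only [map_add, ha, hb]) (fun m hm => ?_)
      fun m hm => ?_
    · rw [hE0 m hm, hE0 _ (sub_mem hm (hρ₀ m).2), map_sub, hρ₀' _ (hρ₀ m).1 (hρ₀ m).2]
      simp
    · rw [hE1 m hm, hE1 _ (hρ₁ m).2, hρ₁' _ (hρ₁ m).1 (hρ₁ m).2]
  rcases hindec.eq_zero_or_eq_id k _ hhom hidem with h | h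
  · refine ⟨1, fun m hm => hR m ?_⟩
    have := hE0 m hm
    rw [h, LinearMap.zero_apply] at this
    rw [sub_eq_zero.1 this.symm]
    exact (hρ₀ m).1
  · refine ⟨0, fun m hm => hR m ?_⟩
    have := hE1 m hm
    rw [h] at this
    rw [this]
    exact (hρ₁ m).1

/-- If an indecomposable module is a pencil of maps from parity `p` to parity `p + 1` with a
kernel at every point, then `x` maps onto the component of parity `p + 1`. -/
theorem X_surjective_of_pencil_not_injective [FiniteDimensional k M] {p : ZMod 2}
    (hindec : IsIndecomposableSupermodule k (SL11 k) M)
    (hp : ∀ m ∈ modPart k (SL11 k) M (p + 1), X k M m = 0 ∧ Y k M m = 0)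
    (h : ∀ s : k, ∃ m ∈ modPart k (SL11 k) M p, m ≠ 0 ∧ X k M m = s • Y k M m) :
    ∀ w ∈ modPart k (SL11 k) M (p + 1), ∃ m, X k M m = w := by
  obtain ⟨P, Q, hP0, hPP, hQQ, hXP, hYP, hQX⟩ := exists_idempotent_of_pencil_not_injective
    (X k M ∘ₗ (modPart k (SL11 k) M p).subtype) (Y k M ∘ₗ (modPart k (SL11 k) M p).subtype)
    (fun s => by
      obtain ⟨m, hm, hm0, hs⟩ := h s
      exact ⟨⟨m, hm⟩, by simpa [Subtype.ext_iff] using hm0, hs⟩)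
  have hQmem : ∀ w, Q w ∈ modPart k (SL11 k) M (p + 1) := fun w => by
    obtain ⟨v, hv⟩ := hQX w
    rw [hv]
    exact X_mem k v.2
  -- P and Q glue to an idempotent endomorphism of M. It is nonzero because P is, so Q is the
  -- identity on parity p + 1.
  let E : M →ₗ[k] M := (modPart k (SL11 k) M p).subtype ∘ₗ P ∘ₗ
    (Submodule.projectionOnto _ _ (isCompl_modPart k (SL11 k) M p)) +
      Q ∘ₗ parityProj k (SL11 k) M (p + 1)
  have hE0 : ∀ m : modPart k (SL11 k) M p, E m = P m := fun m => by
    have h1 : (m : M) ∈ modPart k (SL11 k) M (p + 1 + 1) := by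
      rw [ZMod.two_add_one_add_one]; exact m.2
    simp [E, parityProj_of_mem_add_one k _ h1]
  have hE1 : ∀ m ∈ modPart k (SL11 k) M (p + 1), E m = Q m := fun m hm => by
    simp [E, parityProj_of_mem k _ hm, (Submodule.projectionOnto_apply_eq_zero_iff _).2 hm]
  have hparts : ∀ {A : M → Prop}, (∀ a b, A a → A b → A (a + b)) →
      (∀ m : modPart k (SL11 k) M p, A m) → (∀ m ∈ modPart k (SL11 k) M (p + 1), A m) →
      ∀ m, A m := by
    intro A hadd h0 h1 m
    obtain ⟨a, ha, b, hb, rfl⟩ := exists_homogeneous_add k (SL11 k) p m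
    exact hadd _ _ (h0 ⟨a, ha⟩) (h1 b hb)
  have hhom : IsSupermoduleHom k (SL11 k) E := by
    refine isSupermoduleHom_of_comm k _ (fun i m hm => ?_) ?_ ?_
    · obtain rfl | rfl := ZMod.two_eq_or_eq_add_one i p
      · rw [hE0 ⟨m, hm⟩]
        exact (P _).2
      · rw [hE1 m hm]
        exact hQmem m
    · refine hparts (fun a b ha hb => by simp only [map_add, ha, hb]) (fun m => ?_)
        fun m hm => ?_
      · rw [hE0, hE1 _ (X_mem k m.2)]
        exact (hXP m).symm
      · rw [hE1 m hm, (hp m hm).1, (hp _ (hQmem m)).1, map_zero]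
    · refine hparts (fun a b ha hb => by simp only [map_add, ha, hb]) (fun m => ?_)
        fun m hm => ?_
      · rw [hE0, hE1 _ (Y_mem k m.2)]
        exact (hYP m).symm
      · rw [hE1 m hm, (hp m hm).2, (hp _ (hQmem m)).2, map_zero]
  have hidem : ∀ m, E (E m) = E m := by
    refine hparts (fun a b ha hb => by simp only [map_add, ha, hb]) (fun m => ?_)
      fun m hm => ?_
    · rw [hE0, hE0, hPP]
    · rw [hE1 m hm, hE1 _ (hQmem m), hQQ]
  rcases hindec.eq_zero_or_eq_id k _ hhom hidem with h | h
  · refine absurd (LinearMap.ext fun v => Subtype.ext ?_) hP0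
    rw [← hE0, h]
    rfl
  · intro w hw
    obtain ⟨v, hv⟩ := hQX w
    exact ⟨v, by rw [← h w, hE1 w hw, hv]; rfl⟩

end radical

/-- An indecomposable pencil of maps over an algebraically closed field is not exact at every
point. -/
theorem false_of_forall_ker_le_range (k : Type*) [Field k] [IsAlgClosed k] {M : Type*}
    [AddCommGroup M] [Module k M] [LieSupermodule k (SL11 k) M] [FiniteDimensional k M]
    [Nontrivial M] {p : ZMod 2}
    (hp : ∀ m ∈ modPart k (SL11 k) M (p + 1), X k M m = 0 ∧ Y k M m = 0)
    (hY : ∀ m, Y k M m = 0 → ∃ n, Y k M n = m)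
    (h : ∀ s : k, ∀ m, X k M m = s • Y k M m → ∃ n, X k M n - s • Y k M n = m) : False := by
  have hodd : ∀ n, ∃ a : modPart k (SL11 k) M p, Y k M a = Y k M n ∧ X k M a = X k M n := by
    intro n
    obtain ⟨a, ha, b, hb, rfl⟩ := exists_homogeneous_add k (SL11 k) p n
    exact ⟨⟨a, ha⟩, by simp [hp b hb], by simp [hp b hb]⟩
  -- By exactness a kernel vector is in the image, which lies in parity p + 1.
  have hinj : ∀ m ∈ modPart k (SL11 k) M p, Y k M m = 0 → m = 0 := by
    intro m hm h0
    obtain ⟨n, rfl⟩ := hY m h0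
    obtain ⟨a, ha, -⟩ := hodd n
    exact eq_zero_of_mem_of_mem k _ hm (ha ▸ Y_mem k a.2)
  have hinj' : ∀ s : k, ∀ m ∈ modPart k (SL11 k) M p, X k M m = s • Y k M m → m = 0 := by
    intro s m hm h0
    obtain ⟨n, rfl⟩ := h s m h0
    obtain ⟨a, ha, ha'⟩ := hodd n
    refine eq_zero_of_mem_of_mem k _ hm ?_
    rw [← ha, ← ha']
    exact sub_mem (X_mem k a.2) (Submodule.smul_mem _ _ (Y_mem k a.2))
  let Y' : modPart k (SL11 k) M p →ₗ[k] modPart k (SL11 k) M (p + 1) :=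
    (Y k M).restrict fun m hm => Y_mem k hm
  let X' : modPart k (SL11 k) M p →ₗ[k] modPart k (SL11 k) M (p + 1) :=
    (X k M).restrict fun m hm => X_mem k hm
  have hbij : Function.Bijective Y' := by
    constructor
    · rw [injective_iff_map_eq_zero]
      intro a ha
      exact Subtype.ext (hinj a a.2 (congrArg Subtype.val ha))
    · intro w
      obtain ⟨n, hn⟩ := hY w (hp w w.2).2
      obtain ⟨a, ha, -⟩ := hodd n
      exact ⟨a, Subtype.ext (ha.trans hn)⟩
  let e := LinearEquiv.ofBijective Y' hbij
  by_cases hnt : Nontrivial (modPart k (SL11 k) M p)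
  -- An eigenvector of `y⁻¹ x` with eigenvalue s is a kernel vector of `x - s y`.
  · obtain ⟨s, hs⟩ := Module.End.exists_eigenvalue (e.symm.toLinearMap ∘ₗ X')
    obtain ⟨a, ha⟩ := hs.exists_hasEigenvector
    have h1 : e.symm (X' a) = s • a := ha.apply_eq_smul
    rw [LinearEquiv.symm_apply_eq, map_smul] at h1
    exact ha.2 (Subtype.ext (hinj' s a a.2 (congrArg Subtype.val h1)))
  · rw [not_nontrivial_iff_subsingleton] at hnt
    have hs' : Subsingleton (modPart k (SL11 k) M (p + 1)) := e.symm.toEquiv.subsingleton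
    obtain ⟨m, hm⟩ := exists_ne (0 : M)
    obtain ⟨a, ha, b, hb, rfl⟩ := exists_homogeneous_add k (SL11 k) p m
    apply hm
    have h1 : a = 0 := congrArg Subtype.val (Subsingleton.elim (⟨a, ha⟩ : modPart k (SL11 k) M p) 0)
    have h2 : b = 0 :=
      congrArg Subtype.val (Subsingleton.elim (⟨b, hb⟩ : modPart k (SL11 k) M (p + 1)) 0)
    rw [h1, h2, add_zero]

/-! ### Consequences of a super Jordan type -/

section jordan

variable {k : Type*} {L : Type*} [Field k] [AddCommGroup L] [Module k L] [LieSuperalgebra k L]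
variable {V : Type*} [AddCommGroup V] [Module k V] [LieSupermodule k L V]
variable {z : L} {aev aod a₂ : ℕ}

theorem _root_.HasSuperJordanTypeAt.act_act (h : HasSuperJordanTypeAt k L V z aev aod a₂) (m : V) :
    superAct k L V z (superAct k L V z m) = 0 := by
  obtain ⟨b, h1, h2, h3⟩ := h
  have : superAct k L V z ∘ₗ superAct k L V z = 0 := by
    refine b.ext fun i => ?_
    rcases i with i | i | ⟨l, j⟩
    · simp [h1]
    · simp [h2]
    · fin_cases j
      · simp [(h3 l).2.1, (h3 l).2.2]
      · simp [(h3 l).2.2]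
  exact LinearMap.congr_fun this m

/-- The coordinate along a trivial basis vector vanishes on the image of z. -/
theorem _root_.HasSuperJordanTypeAt.exists_even (h : HasSuperJordanTypeAt k L V z aev aod a₂)
    (ha : aev ≠ 0) :
    ∃ m ∈ modPart k L V 0, m ≠ 0 ∧ superAct k L V z m = 0 ∧ ∀ n, superAct k L V z n ≠ m := by
  obtain ⟨b, h1, h2, h3⟩ := h
  let i : Fin aev := ⟨0, by omega⟩
  refine ⟨_, (h1 i).1, b.ne_zero _, (h1 i).2, fun n hn => ?_⟩
  have : b.coord (.inl i) ∘ₗ superAct k L V z = 0 := by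
    refine b.ext fun i => ?_
    rcases i with i | i | ⟨l, j⟩
    · simp [h1]
    · simp [h2]
    · fin_cases j
      · simp [(h3 l).2.1]
      · simp [(h3 l).2.2]
  have := LinearMap.congr_fun this n
  simp [hn] at this

theorem _root_.HasSuperJordanTypeAt.exists_odd (h : HasSuperJordanTypeAt k L V z aev aod a₂)
    (ha : aod ≠ 0) :
    ∃ m ∈ modPart k L V 1, m ≠ 0 ∧ superAct k L V z m = 0 ∧ ∀ n, superAct k L V z n ≠ m := by
  obtain ⟨b, h1, h2, h3⟩ := h
  let i : Fin aod := ⟨0, by omega⟩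
  refine ⟨_, (h2 i).1, b.ne_zero _, (h2 i).2, fun n hn => ?_⟩
  have : b.coord (.inr (.inl i)) ∘ₗ superAct k L V z = 0 := by
    refine b.ext fun i => ?_
    rcases i with i | i | ⟨l, j⟩
    · simp [h1]
    · simp [h2]
    · fin_cases j
      · simp [(h3 l).2.1]
      · simp [(h3 l).2.2]
  have := LinearMap.congr_fun this n
  simp [hn] at this

/-- Without trivial summands there is a contracting homotopy s with `z s + s z = 1`, sending `z p`
back to `p` in each block. -/
theorem _root_.HasSuperJordanTypeAt.exists_of_act_eq_zero
    (h : HasSuperJordanTypeAt k L V z 0 0 a₂) {m : V} (hm : superAct k L V z m = 0) :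
    ∃ n, superAct k L V z n = m := by
  obtain ⟨b, -, -, h3⟩ := h
  let s : V →ₗ[k] V := b.constr k fun i => match i with
    | .inl i => i.elim0
    | .inr (.inl i) => i.elim0
    | .inr (.inr (l, j)) => if j = 0 then 0 else b (.inr (.inr (l, 0)))
  have hs : superAct k L V z ∘ₗ s + s ∘ₗ superAct k L V z = LinearMap.id := by
    refine b.ext fun i => ?_
    rcases i with i | i | ⟨l, j⟩
    · exact i.elim0
    · exact i.elim0
    · fin_cases j
      · simp [s, (h3 l).2.1]
      · simp [s, (h3 l).2.1, (h3 l).2.2]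
  have := LinearMap.congr_fun hs m
  simp only [LinearMap.add_apply, LinearMap.comp_apply, hm, map_zero, add_zero,
    LinearMap.id_apply] at this
  exact ⟨_, this⟩

end jordan

end SL11

/-! ### The main theorem -/

theorem mainTheorem8 (k : Type u) [Field k] [IsAlgClosed k] [CharZero k]
    (M : Type v) [AddCommGroup M] [Module k M] [LieSupermodule k (SL11 k) M]
    (hF : InCategoryF k (SL11 k) M)
    (hindec : IsIndecomposableSupermodule k (SL11 k) M)
    (hnonproj : ¬ IsProjectiveInF k (SL11 k) M)
    (aev aod a₂ : ℕ)
    (hM : HasStrongConstantJordanType k (SL11 k) M aev aod a₂) :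
    (aev = 0 ∧ aod ≠ 0) ∨ (aev ≠ 0 ∧ aod = 0) := by
  have := hF.finiteDimensional
  have := hindec.1
  have hx := hM (SL11.x k) SL11.x_mem fun h => by
    simpa [SL11.x] using congrFun (congrFun (congrArg Subtype.val h) 0) 1
  have hy := hM (SL11.y k) SL11.y_mem fun h => by
    simpa [SL11.y] using congrFun (congrFun (congrArg Subtype.val h) 1) 0
  have hs : ∀ s : k, HasSuperJordanTypeAt k (SL11 k) M (SL11.x k - s • SL11.y k) aev aod a₂ :=
    fun s => hM _ (sub_mem SL11.x_mem (Submodule.smul_mem _ _ SL11.y_mem)) fun h => by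
      simpa [SL11.x, SL11.y] using congrFun (congrFun (congrArg Subtype.val h) 0) 1
  have hact : ∀ (s : k) (m : M), superAct k (SL11 k) M (SL11.x k - s • SL11.y k) m =
      SL11.X k M m - s • SL11.Y k M m := fun s m => by
    simp [superAct, SL11.X, SL11.Y]
  -- This is where the type at a non-self-commuting element enters: s = -1 gives `(x + y)² = x y + y
  -- x = t`.
  have hT : ∀ m, SL11.T k M m = 0 := fun m => by
    have h1 := (hs (-1)).act_act m
    rw [hact, hact] at h1
    simp only [neg_smul, one_smul, sub_neg_eq_add, map_add, SL11.X_X, SL11.Y_Y, zero_add,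
      add_zero] at h1
    rw [← h1, ← SL11.X_Y_add_Y_X, add_comm]
  have hXY : ∀ m, SL11.X k M (SL11.Y k M m) = 0 := by
    have key : ∀ p, ∀ m ∈ modPart k (SL11 k) M p, SL11.X k M (SL11.Y k M m) = 0 := by
      intro p m hm
      by_contra hne
      exact hnonproj (SL11.isProjectiveInF_of_X_Y_ne_zero k hF hindec hT hm hne)
    intro m
    obtain ⟨a, ha, b, hb, rfl⟩ := exists_homogeneous_add k (SL11 k) 0 m
    rw [map_add, map_add, key _ a ha, key _ b hb, add_zero]
  have hYX : ∀ m, SL11.Y k M (SL11.X k M m) = 0 := fun m => by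
    rw [SL11.Y_X_of_T k (hT m), hXY, neg_zero]
  obtain ⟨p, hp⟩ := SL11.exists_parity_killed k hindec hXY hYX
  have hnot : ¬ (aev ≠ 0 ∧ aod ≠ 0) := by
    rintro ⟨hev, hod⟩
    have hall : ∀ z : SL11 k, HasSuperJordanTypeAt k (SL11 k) M z aev aod a₂ → ∀ i : ZMod 2,
        ∃ m ∈ modPart k (SL11 k) M i, m ≠ 0 ∧ superAct k (SL11 k) M z m = 0 ∧
          ∀ n, superAct k (SL11 k) M z n ≠ m := by
      intro z hz i
      obtain rfl | rfl := ZMod.two_eq_zero_or_eq_one i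
      · exact hz.exists_even hev
      · exact hz.exists_odd hod
    -- The trivial summands in parity p feed the pencil lemma; the one for `x` in parity p + 1
    -- contradicts surjectivity.
    obtain ⟨w, hw, -, -, hw'⟩ := hall _ hx (p + 1)
    obtain ⟨m, hm⟩ := SL11.X_surjective_of_pencil_not_injective k hindec hp (fun s => by
      obtain ⟨m, hm, hm0, hz, -⟩ := hall _ (hs s) p
      exact ⟨m, hm, hm0, sub_eq_zero.1 ((hact s m).symm.trans hz)⟩) w hw
    exact hw' m hm
  have hnot' : ¬ (aev = 0 ∧ aod = 0) := by
    rintro ⟨rfl, rfl⟩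
    refine SL11.false_of_forall_ker_le_range k hp (fun m hm => hy.exists_of_act_eq_zero hm)
      fun s m hm => ?_
    obtain ⟨n, hn⟩ := (hs s).exists_of_act_eq_zero (m := m) (by rw [hact, hm, sub_self])
    exact ⟨n, by rw [← hn, hact]⟩
  tauto
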